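/- Graphs are finite and may have loops and parallel edges. For a graph $G=(V,E,\phi)$ put $\Delta(G)=|E(G)|-|V(G)|$, and for $X\subseteq E(G)$ let $G\langle X\rangle$ be the subgraph of $G$ formed by the edges in $X$ and their end vertices. A graph is a \emph{cacti-graph} if it has no isolated vertices, no leaves (vertices of degree one, a loop counting twice), and no component that is a cycle (a vertex with one loop, or two vertices joined by two parallel edges, being cycles). For an integer $k\ge 1$ the \emph{$k$-circular matroid} $M_k(G)$ is the matroid on $E(G)$ whose circuits are the sets $C\subseteq E(G)$ such that $\Delta(G\langle C\rangle)=k$ and $G\langle C\rangle$ is a cacti-graph. For a vertex $x$, $S(x,G)$ is the set of edges incident to $x$, $\mathcal S(G)=\{S(x,G):x\in V(G)\}$, and $G\setminus x$ is obtained from $G$ by deleting $x$ and all edges incident to $x$. Graphs $G=(V,E,\phi)$ and $G'=(V',E',\phi')$ are \emph{strongly isomorphic} if $E=E'$ and there is a bijection $\nu:V\to V'$ such that $\phi(e)=\{x,y\}\Leftrightarrow\phi'(e)=\{\nu(x),\nu(y)\}$ for all $e\in E$ and $x,y\in V$. \textbf{Theorem.} Let $k\ge 2$, and let $G$ and $G'$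 be graphs, where $G'$ has no isolated vertices. Suppose that (a1) $\Delta(G)\ge k$ and $G$ is a cacti-graph, (a2) $\Delta(G\setminus x)\ge k$ and $G\setminus x$ is a cacti-graph for every vertex $x$ of $G$, and (a3) $M_k(G')=M_k(G)$. Then $\mathcal S(G)=\mathcal S(G')$, and $G$ and $G'$ are strongly isomorphic. -/

import Mathlib

open scoped Graph

namespace Graph

variable {α α' β : Type*}

/-! ### Basic notions for finite graphs (loops and parallel edges are allowed) -/

/-- The degree of a vertex in a finite graph; every loop counts twice. -/
noncomputable def degree (G : Graph α β) (v : α) : ℕ :=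
  (G.incidenceSet v).ncard + (G.loopSet v).ncard

/-- `v` is an isolated vertex: no edge is incident to it. -/
def IsIsolated (G : Graph α β) (v : α) : Prop :=
  v ∈ V(G) ∧ G.incidenceSet v = ∅

/-- `v` is a leaf: a vertex of degree one. -/
def IsLeaf (G : Graph α β) (v : α) : Prop :=
  v ∈ V(G) ∧ G.degree v = 1

/-- `w` can be reached from `v` along edges of the graph. -/
def Reachable (G : Graph α β) (v w : α) : Prop :=
  Relation.ReflTransGen G.Adj v w

/-- The component of `G` containing the vertex `v`. -/
def component (G : Graph α β) (v : α) : Graph α β :=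
  G.induce {w | w ∈ V(G) ∧ G.Reachable v w}

/-- A finite graph is a cycle if it is non-empty, connected, and 2-regular (a vertex with a single
loop and a pair of parallel edges are cycles). -/
def IsCycleGraph (H : Graph α β) : Prop :=
  V(H).Nonempty ∧ (∀ v ∈ V(H), ∀ w ∈ V(H), H.Reachable v w) ∧ ∀ v ∈ V(H), H.degree v = 2

/-- A cacti-graph: no isolated vertices, no leaves, no cycle components. -/
def IsCactiGraph (G : Graph α β) : Prop :=
  (∀ v, ¬ G.IsIsolated v) ∧ (∀ v, ¬ G.IsLeaf v) ∧ ∀ v ∈ V(G), ¬ (G.component v).IsCycleGraph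

/-- `Δ(G) = |E(G)| - |V(G)|`. -/
noncomputable def excess (G : Graph α β) : ℤ :=
  (E(G).ncard : ℤ) - (V(G).ncard : ℤ)

/-- The subgraph `G⟨X⟩` of `G` induced by the edges in `X`: its vertices are the ends of the
edges in `X`. -/
def edgeInduce (G : Graph α β) (X : Set β) : Graph α β :=
  (G.restrict X).induce {v | ∃ e ∈ X, G.Inc e v}

/-- The set `S(G)` of vertex stars of `G`. -/
def vertexStars (G : Graph α β) : Set (Set β) :=
  {S | ∃ v ∈ V(G), S = G.incidenceSet v}

/-- Strong isomorphism: the edge sets are equal, and some bijection of the vertex sets preserves the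
ends of every edge. -/
def StronglyIsomorphic (G : Graph α β) (G' : Graph α' β) : Prop :=
  E(G) = E(G') ∧ ∃ ν : V(G) ≃ V(G'), ∀ (e : β) (x y : V(G)),
    G.IsLink e x y ↔ G'.IsLink e (ν x) (ν y)

/-- The family `C_k(G)`: sets `C` of edges such that `Δ(G⟨C⟩) = k` and `G⟨C⟩` is a cacti-graph. -/
def kCircuits (G : Graph α β) (k : ℕ) : Set (Set β) :=
  {C | C ⊆ E(G) ∧ (G.edgeInduce C).excess = k ∧ (G.edgeInduce C).IsCactiGraph}

/-! ### `C_k(G)` is the family of circuits of a matroid on `E(G)` -/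

section Aux

variable {G : Graph α β} {X Y Z : Set β} {k : ℕ}

lemma edgeInduce_vertexSet (G : Graph α β) (X : Set β) :
    V(G.edgeInduce X) = {v | ∃ e ∈ X, G.Inc e v} := rfl

lemma edgeInduce_isLink {e : β} {x y : α} :
    (G.edgeInduce X).IsLink e x y ↔ G.IsLink e x y ∧ e ∈ X := by
  simp only [edgeInduce, induce_isLink, restrict_isLink, Set.mem_ofPred_eq]
  constructor
  · tauto
  · rintro ⟨h, he⟩
    exact ⟨⟨he, h⟩, ⟨e, he, h.inc_left⟩, ⟨e, he, h.inc_right⟩⟩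

lemma edgeInduce_inc {e : β} {x : α} : (G.edgeInduce X).Inc e x ↔ G.Inc e x ∧ e ∈ X := by
  simp [Inc, edgeInduce_isLink]

lemma edgeInduce_edgeSet (hX : X ⊆ E(G)) : E(G.edgeInduce X) = X := by
  ext e
  rw [edge_mem_iff_exists_isLink]
  simp only [edgeInduce_isLink]
  constructor
  · rintro ⟨x, y, -, h⟩; exact h
  · intro h
    obtain ⟨x, y, hxy⟩ := exists_isLink_of_mem_edgeSet (hX h)
    exact ⟨x, y, hxy, h⟩

lemma finite_ends (G : Graph α β) (e : β) : {v | G.Inc e v}.Finite := by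
  by_cases he : e ∈ E(G)
  · obtain ⟨x, y, hxy⟩ := exists_isLink_of_mem_edgeSet he
    exact (Set.toFinite {x, y}).subset fun v hv => hv.eq_or_eq_of_isLink hxy
  · convert Set.finite_empty
    ext v
    simp [not_inc_of_notMem_edgeSet he]

lemma edgeInduce_vertexSet_finite (G : Graph α β) (hX : X.Finite) : V(G.edgeInduce X).Finite := by
  have : V(G.edgeInduce X) = ⋃ e ∈ X, {v | G.Inc e v} := by
    ext v; simp [edgeInduce_vertexSet]
  rw [this]
  exact hX.biUnion fun e _ => G.finite_ends e

lemma edgeInduce_excess (hX : X ⊆ E(G)) :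
    (G.edgeInduce X).excess = (X.ncard : ℤ) - (V(G.edgeInduce X).ncard : ℤ) := by
  rw [excess, edgeInduce_edgeSet hX]

lemma edgeInduce_vertexSet_mono (h : X ⊆ Y) : V(G.edgeInduce X) ⊆ V(G.edgeInduce Y) := by
  rintro v ⟨e, he, hv⟩
  exact ⟨e, h he, hv⟩

lemma excess_empty : (G.edgeInduce ∅).excess = 0 := by
  rw [edgeInduce_excess (Set.empty_subset _)]
  simp [edgeInduce_vertexSet]

lemma excess_supermodular (hE : E(G).Finite) (hX : X ⊆ E(G)) (hY : Y ⊆ E(G)) :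
    (G.edgeInduce X).excess + (G.edgeInduce Y).excess ≤
      (G.edgeInduce (X ∪ Y)).excess + (G.edgeInduce (X ∩ Y)).excess := by
  have fX := hE.subset hX
  have fY := hE.subset hY
  rw [edgeInduce_excess hX, edgeInduce_excess hY, edgeInduce_excess (Set.union_subset hX hY),
    edgeInduce_excess (Set.inter_subset_left.trans hX)]
  have h1 := Set.ncard_union_add_ncard_inter X Y fX fY
  have gX := G.edgeInduce_vertexSet_finite fX
  have gY := G.edgeInduce_vertexSet_finite fY
  have h2 := Set.ncard_union_add_ncard_inter _ _ gX gY
  have h3 : V(G.edgeInduce (X ∪ Y)) = V(G.edgeInduce X) ∪ V(G.edgeInduce Y) := by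
    ext v
    simp only [edgeInduce_vertexSet, Set.mem_ofPred_eq, Set.mem_union]
    constructor
    · rintro ⟨e, h | h, hv⟩
      exacts [Or.inl ⟨e, h, hv⟩, Or.inr ⟨e, h, hv⟩]
    · rintro (⟨e, h, hv⟩ | ⟨e, h, hv⟩)
      exacts [⟨e, Or.inl h, hv⟩, ⟨e, Or.inr h, hv⟩]
  have h4 : V(G.edgeInduce (X ∩ Y)).ncard ≤ (V(G.edgeInduce X) ∩ V(G.edgeInduce Y)).ncard :=
    Set.ncard_le_ncard (Set.subset_inter (edgeInduce_vertexSet_mono Set.inter_subset_left)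
      (edgeInduce_vertexSet_mono Set.inter_subset_right)) (gX.inter_of_left _)
  rw [h3]
  omega

lemma excess_le_of_subset (hE : E(G).Finite) (hY : Y ⊆ E(G)) (h : Z ⊆ Y) :
    (G.edgeInduce Y).excess ≤ (G.edgeInduce Z).excess + ((Y \ Z).ncard : ℤ) := by
  have fY := hE.subset hY
  rw [edgeInduce_excess hY, edgeInduce_excess (h.trans hY)]
  have h1 := Set.ncard_sdiff_add_ncard_of_subset h fY
  have h2 := Set.ncard_le_ncard (edgeInduce_vertexSet_mono (G := G) h)
    (G.edgeInduce_vertexSet_finite fY)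
  omega

/-- Double counting of the incidences between a vertex set `W` and the edges meeting `W`. -/
lemma sum_degree (W : Finset α) {S : Finset β}
    (hS : ∀ e, e ∈ S ↔ ∃ v ∈ W, G.Inc e v) :
    ∑ v ∈ W, G.degree v ≤ 2 * S.card ∧
      ((∀ e v w, G.IsLink e v w → v ∈ W → w ∈ W) ↔ ∑ v ∈ W, G.degree v = 2 * S.card) := by
  classical
  have key : ∑ v ∈ W, G.degree v =
      ∑ e ∈ S, ((W.filter fun v => G.Inc e v).card + (W.filter fun v => G.IsLoopAt e v).card) := by
    rw [Finset.sum_add_distrib]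
    simp only [Finset.card_filter]
    rw [Finset.sum_comm, Finset.sum_comm (s := S) (t := W) (f := fun e v =>
      if G.IsLoopAt e v then 1 else 0), ← Finset.sum_add_distrib]
    refine Finset.sum_congr rfl fun v hv => ?_
    simp only [← Finset.card_filter]
    rw [degree, ← Set.ncard_coe_finset, ← Set.ncard_coe_finset]
    congr 2
    · ext e
      simp only [mem_incidenceSet, Finset.coe_filter, Set.mem_ofPred_eq]
      exact ⟨fun h => ⟨(hS e).2 ⟨v, hv, h⟩, h⟩, fun h => h.2⟩
    · ext e
      simp only [mem_loopSet, Finset.coe_filter, Set.mem_ofPred_eq]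
      exact ⟨fun h => ⟨(hS e).2 ⟨v, hv, h.inc⟩, h⟩, fun h => h.2⟩
  have each : ∀ e ∈ S,
      (W.filter fun v => G.Inc e v).card + (W.filter fun v => G.IsLoopAt e v).card ≤ 2 ∧
      ((∀ v w, G.IsLink e v w → v ∈ W → w ∈ W) ↔
        (W.filter fun v => G.Inc e v).card + (W.filter fun v => G.IsLoopAt e v).card = 2) := by
    intro e he
    obtain ⟨x, hx, y, hxy⟩ := (hS e).1 he
    by_cases hyx : y = x
    · subst hyx
      have e1 : (W.filter fun v => G.Inc e v) = {y} := by
        ext v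
        simp only [Finset.mem_filter, Finset.mem_singleton]
        constructor
        · rintro ⟨-, h⟩; simpa using h.eq_or_eq_of_isLink hxy
        · rintro rfl; exact ⟨hx, hxy.inc_left⟩
      have e2 : (W.filter fun v => G.IsLoopAt e v) = {y} := by
        ext v
        simp only [Finset.mem_filter, Finset.mem_singleton]
        constructor
        · rintro ⟨-, h⟩; simpa using h.inc.eq_or_eq_of_isLink hxy
        · rintro rfl; exact ⟨hx, hxy⟩
      rw [e1, e2]
      simp only [Finset.card_singleton, Nat.reduceAdd, le_refl, iff_true, true_and]
      intro v w h _
      have : w = y := by simpa using h.inc_right.eq_or_eq_of_isLink hxy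
      rwa [this]
    · have e2 : (W.filter fun v => G.IsLoopAt e v) = ∅ := by
        ext v
        simp only [Finset.mem_filter, Finset.notMem_empty, iff_false, not_and]
        intro _ h
        have h1 := h.eq_of_inc hxy.inc_left
        have h2 := h.eq_of_inc hxy.inc_right
        exact hyx (h2.symm.trans h1)
      rw [e2]
      by_cases hy : y ∈ W
      · have e1 : (W.filter fun v => G.Inc e v) = {x, y} := by
          ext v
          simp only [Finset.mem_filter, Finset.mem_singleton, Finset.mem_insert]
          constructor
          · rintro ⟨-, h⟩; exact h.eq_or_eq_of_isLink hxy
          · rintro (rfl | rfl)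
            exacts [⟨hx, hxy.inc_left⟩, ⟨hy, hxy.inc_right⟩]
        rw [e1, Finset.card_pair (Ne.symm hyx)]
        simp only [Finset.card_empty, add_zero, le_refl, iff_true, true_and]
        intro v w h _
        rcases h.inc_right.eq_or_eq_of_isLink hxy with h | h <;> rwa [h]
      · have e1 : (W.filter fun v => G.Inc e v) = {x} := by
          ext v
          simp only [Finset.mem_filter, Finset.mem_singleton]
          constructor
          · rintro ⟨hv, h⟩
            rcases h.eq_or_eq_of_isLink hxy with h | h
            · exact h
            · exact absurd (h ▸ hv) hy
          · rintro rfl; exact ⟨hx, hxy.inc_left⟩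
        rw [e1]
        simp only [Finset.card_singleton, Finset.card_empty, add_zero, Nat.one_le_ofNat,
          OfNat.one_ne_ofNat, iff_false, true_and]
        intro h
        exact hy (h x y hxy hx)
  have two : 2 * S.card = ∑ e ∈ S, 2 := by simp [mul_comm]
  rw [key, two]
  refine ⟨Finset.sum_le_sum fun e he => (each e he).1, ?_⟩
  rw [Finset.sum_eq_sum_iff_of_le fun e he => (each e he).1]
  constructor
  · intro h e he
    exact (each e he).2.1 (h e)
  · intro h e v w hvw hv
    have he : e ∈ S := (hS e).2 ⟨v, hv, hvw.inc_left⟩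
    exact (each e he).2.2 (h e he) v w hvw hv

lemma component_isLink {v x y : α} {e : β} :
    (G.component v).IsLink e x y ↔ G.IsLink e x y ∧ G.Reachable v x := by
  simp only [component, induce_isLink, Set.mem_ofPred_eq]
  constructor
  · rintro ⟨h, ⟨-, hx⟩, -⟩; exact ⟨h, hx⟩
  · rintro ⟨h, hx⟩
    exact ⟨h, ⟨h.left_mem, hx⟩, ⟨h.right_mem, hx.tail ⟨e, h⟩⟩⟩

lemma component_degree {v w : α} (h : G.Reachable v w) : (G.component v).degree w = G.degree w := by
  have e1 : (G.component v).incidenceSet w = G.incidenceSet w := by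
    ext e
    simp [Inc, component_isLink, h]
  have e2 : (G.component v).loopSet w = G.loopSet w := by
    ext e
    simp [← isLink_self_iff, component_isLink, h]
  rw [degree, degree, e1, e2]

lemma Reachable.symm {v w : α} (h : G.Reachable v w) : G.Reachable w v := by
  induction h with
  | refl => exact .refl
  | tail _ h2 ih => exact Relation.ReflTransGen.head h2.symm ih

lemma component_reachable {v w : α} (h : G.Reachable v w) : (G.component v).Reachable v w := by
  induction h with
  | refl => exact .refl
  | tail h1 h2 ih =>
    obtain ⟨e, he⟩ := h2
    exact ih.tail ⟨e, component_isLink.2 ⟨he, h1⟩⟩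

lemma component_isCycleGraph_iff {v : α} (hv : v ∈ V(G)) :
    (G.component v).IsCycleGraph ↔ ∀ w, G.Reachable v w → G.degree w = 2 := by
  have mem : ∀ {w}, G.Reachable v w → w ∈ V(G) := by
    intro w h
    rcases Relation.ReflTransGen.cases_tail h with h | ⟨c, -, h⟩
    · exact h ▸ hv
    · exact h.right_mem
  constructor
  · rintro ⟨-, -, h⟩ w hw
    rw [← component_degree hw]
    exact h w ⟨mem hw, hw⟩
  · intro h
    refine ⟨⟨v, hv, .refl⟩, ?_, ?_⟩
    · rintro x ⟨-, hx⟩ y ⟨-, hy⟩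
      exact (component_reachable hx).symm.trans (component_reachable hy)
    · rintro w ⟨-, hw⟩
      rw [component_degree hw, h w hw]

lemma exists_minimal_excess (hE : E(G).Finite) (hX : X ⊆ E(G)) {n : ℤ}
    (h : n ≤ (G.edgeInduce X).excess) :
    ∃ C ⊆ X, n ≤ (G.edgeInduce C).excess ∧ ∀ D ⊂ C, (G.edgeInduce D).excess < n := by
  have fX := hE.subset hX
  obtain ⟨C, hC, hmin⟩ := (fX.finite_subsets.subset
    (t := {D | D ⊆ X ∧ n ≤ (G.edgeInduce D).excess}) (fun D hD => hD.1)).exists_le_minimal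
    (a := X) ⟨subset_rfl, h⟩
  refine ⟨C, hC, hmin.prop.2, fun D hD => ?_⟩
  by_contra hcon
  exact hD.not_subset (hmin.le_of_le ⟨hD.subset.trans hC, not_lt.1 hcon⟩ hD.subset)

lemma degree_eq_zero_iff (hE : E(G).Finite) {v : α} : G.degree v = 0 ↔ G.incidenceSet v = ∅ := by
  have f1 := hE.subset (G.incidenceSet_subset_edgeSet v)
  have f2 := f1.subset (G.loopSet_subset_incidenceSet v)
  rw [degree, Nat.add_eq_zero_iff, Set.ncard_eq_zero f1, Set.ncard_eq_zero f2]
  refine ⟨fun h => h.1, fun h => ⟨h, ?_⟩⟩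
  have := G.loopSet_subset_incidenceSet v
  rw [h] at this
  exact Set.subset_empty_iff.1 this

/-- The edge sets in `C_k(G)` are exactly the minimal edge sets of excess at least `k`. -/
lemma mem_kCircuits_iff (hE : E(G).Finite) (hk : 1 ≤ k) {C : Set β} (hC : C ⊆ E(G)) :
    C ∈ G.kCircuits k ↔
      (k : ℤ) ≤ (G.edgeInduce C).excess ∧ ∀ D ⊂ C, (G.edgeInduce D).excess < k := by
  classical
  have fC := hE.subset hC
  set H := G.edgeInduce C with hH
  have hEH : E(H) = C := edgeInduce_edgeSet hC
  have fEH : E(H).Finite := hEH ▸ fC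
  have fVH : V(H).Finite := G.edgeInduce_vertexSet_finite fC
  have hVH : ∀ v, v ∈ V(H) ↔ ∃ e ∈ C, G.Inc e v := fun v => Iff.rfl
  constructor
  · rintro ⟨-, hex, hiso, hleaf, hcyc⟩
    refine ⟨hex.ge, fun D hD => ?_⟩
    rw [← hH] at hex hiso hleaf hcyc
    by_contra hcon
    rw [not_lt, ← hex, hH, edgeInduce_excess hC, edgeInduce_excess (hD.subset.trans hC)] at hcon
    have fD := fC.subset hD.subset
    have hsub := edgeInduce_vertexSet_mono (G := G) hD.subset
    have c1 := Set.ncard_sdiff_add_ncard_of_subset hD.subset fC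
    have c2 := Set.ncard_sdiff_add_ncard_of_subset hsub fVH
    have c3 : (C \ D).ncard ≤ (V(H) \ V(G.edgeInduce D)).ncard := by
      rw [← hH] at c2 hcon
      omega
    set W := (fVH.sdiff (t := V(G.edgeInduce D))).toFinset with hW
    have memW : ∀ v, v ∈ W ↔ v ∈ V(H) ∧ v ∉ V(G.edgeInduce D) := by intro v; simp [hW]
    set S := fC.toFinset.filter fun e => ∃ v ∈ W, H.Inc e v with hS
    have memS : ∀ e, e ∈ S ↔ ∃ v ∈ W, H.Inc e v := by
      intro e
      simp only [hS, Finset.mem_filter, Set.Finite.mem_toFinset, and_iff_right_iff_imp]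
      rintro ⟨v, -, h⟩
      exact (edgeInduce_inc.1 h).2
    have hSsub : (S : Set β) ⊆ C \ D := by
      intro e he
      obtain ⟨v, hv, hev⟩ := (memS e).1 he
      refine ⟨(edgeInduce_inc.1 hev).2, fun heD => ((memW v).1 hv).2 ⟨e, heD, ?_⟩⟩
      exact (edgeInduce_inc.1 hev).1
    have c4 : S.card ≤ (C \ D).ncard := by
      rw [← Set.ncard_coe_finset]
      exact Set.ncard_le_ncard hSsub fC.sdiff
    have c5 : (V(H) \ V(G.edgeInduce D)).ncard = W.card := by
      rw [hW, Set.ncard_eq_toFinset_card _ (fVH.sdiff)]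
    have hdeg : ∀ v ∈ W, 2 ≤ H.degree v := by
      intro v hv
      have hvV := ((memW v).1 hv).1
      have h0 : H.degree v ≠ 0 := fun h => hiso v ⟨hvV, (degree_eq_zero_iff fEH).1 h⟩
      have h1 : H.degree v ≠ 1 := fun h => hleaf v ⟨hvV, h⟩
      omega
    obtain ⟨d1, d2⟩ := sum_degree W memS
    have d3 : ∑ v ∈ W, 2 ≤ ∑ v ∈ W, H.degree v := Finset.sum_le_sum hdeg
    have d4 : ∑ v ∈ W, 2 = 2 * W.card := by simp [mul_comm]
    have hclosed := d2.2 (by omega)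
    have heq : ∑ v ∈ W, 2 = ∑ v ∈ W, H.degree v := by omega
    rw [Finset.sum_eq_sum_iff_of_le hdeg] at heq
    have hpos : 0 < (C \ D).ncard := by
      rw [Set.ncard_pos fC.sdiff]
      exact Set.nonempty_of_ssubset hD
    obtain ⟨v, hv⟩ : W.Nonempty := by
      rw [← Finset.card_pos]; omega
    have hvV := ((memW v).1 hv).1
    refine hcyc v hvV ((component_isCycleGraph_iff hvV).2 fun w hw => ?_)
    have : w ∈ W := by
      induction hw with
      | refl => exact hv
      | tail _ h2 ih =>
        obtain ⟨e, he⟩ := h2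
        exact hclosed e _ _ he ih
    exact (heq w this).symm
  · rintro ⟨hge, hmin⟩
    -- if removing the edges of `T` removes at least `|T|` vertices, then `T` is empty
    have hrem : ∀ T ⊆ C, ∀ U ⊆ V(H), T.ncard ≤ U.ncard →
        (∀ e ∈ C \ T, ∀ u ∈ U, ¬ G.Inc e u) → T = ∅ := by
      intro T hT U hU hTU hno
      by_contra hne
      have hss : C \ T ⊂ C := by
        refine ⟨Set.sdiff_subset, fun h => ?_⟩
        obtain ⟨e, he⟩ := Set.nonempty_iff_ne_empty.2 hne
        exact (h (hT he)).2 he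
      have h1 := hmin _ hss
      rw [edgeInduce_excess (hss.subset.trans hC)] at h1
      rw [hH, edgeInduce_excess hC, ← hH] at hge
      have c1 := Set.ncard_sdiff_add_ncard_of_subset hT fC
      have hVsub : V(G.edgeInduce (C \ T)) ⊆ V(H) \ U := by
        rintro v ⟨e, he, hev⟩
        exact ⟨⟨e, he.1, hev⟩, fun hvU => hno e he v hvU hev⟩
      have c2 := Set.ncard_le_ncard hVsub fVH.sdiff
      have c3 := Set.ncard_sdiff_add_ncard_of_subset hU fVH
      omega
    refine ⟨hC, le_antisymm ?_ hge, ?_, ?_, ?_⟩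
    · have hne : C.Nonempty := by
        rw [Set.nonempty_iff_ne_empty]
        intro h0
        rw [hH, h0, excess_empty] at hge
        omega
      obtain ⟨e, he⟩ := hne
      have h1 := excess_le_of_subset (Z := C \ {e}) hE hC Set.sdiff_subset
      have h2 := hmin (C \ {e}) ⟨Set.sdiff_subset, fun h => (h he).2 rfl⟩
      have h3 : (C \ (C \ {e})).ncard = 1 := by
        rw [Set.sdiff_sdiff_cancel_left (by simpa using he), Set.ncard_singleton]
      rw [h3] at h1
      push_cast at h1
      omega
    · rintro v ⟨⟨e, he, hev⟩, h⟩
      have : e ∈ H.incidenceSet v := edgeInduce_inc.2 ⟨hev, he⟩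
      rw [h] at this
      exact this
    · rintro v ⟨hv, h⟩
      rw [← hH] at hv h
      have hsub : H.incidenceSet v ⊆ C := hEH ▸ H.incidenceSet_subset_edgeSet v
      have h2 := hrem (H.incidenceSet v) hsub {v} (by simpa using hv)
        (by rw [Set.ncard_singleton]; rw [degree] at h; omega) (by
          rintro e ⟨he, hn⟩ u rfl hu
          exact hn (edgeInduce_inc.2 ⟨hu, he⟩))
      rw [(degree_eq_zero_iff fEH).2 h2] at h
      exact absurd h (by norm_num)
    · intro v hv hcyc
      rw [← hH] at hv hcyc
      rw [component_isCycleGraph_iff hv] at hcyc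
      set W := (fVH.subset (t := {w | w ∈ V(H) ∧ H.Reachable v w}) fun w h => h.1).toFinset
        with hW
      have memW : ∀ w, w ∈ W ↔ w ∈ V(H) ∧ H.Reachable v w := by intro v; simp [hW]
      set S := fC.toFinset.filter fun e => ∃ v ∈ W, H.Inc e v with hS
      have memS : ∀ e, e ∈ S ↔ ∃ v ∈ W, H.Inc e v := by
        intro e
        simp only [hS, Finset.mem_filter, Set.Finite.mem_toFinset, and_iff_right_iff_imp]
        rintro ⟨v, -, h⟩
        exact (edgeInduce_inc.1 h).2
      obtain ⟨-, d2⟩ := sum_degree W memS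
      have d3 := d2.1 (by
        intro e x y hxy hx
        exact (memW y).2 ⟨hxy.right_mem, ((memW x).1 hx).2.tail ⟨e, hxy⟩⟩)
      have d4 : ∑ w ∈ W, H.degree w = ∑ w ∈ W, 2 :=
        Finset.sum_congr rfl fun w hw => hcyc w ((memW w).1 hw).2
      have d5 : ∑ w ∈ W, 2 = 2 * W.card := by simp [mul_comm]
      have h2 := hrem S (by intro e he; simp [hS] at he; exact he.1) W
        (fun w hw => ((memW w).1 hw).1)
        (by rw [Set.ncard_coe_finset, Set.ncard_coe_finset]; omega) (by
          rintro e ⟨he, hn⟩ u hu hue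
          exact hn ((memS e).2 ⟨u, hu, edgeInduce_inc.2 ⟨hue, he⟩⟩))
      obtain ⟨e, he, hev⟩ := hv
      have : e ∈ (S : Set β) := (memS e).2 ⟨v, (memW v).2 ⟨⟨e, he, hev⟩, .refl⟩,
        edgeInduce_inc.2 ⟨hev, he⟩⟩
      rw [h2] at this
      exact this

/-- A set of edges contains no member of `C_k(G)` iff all its subsets have excess less than `k`. -/
lemma forall_notMem_kCircuits_iff (hE : E(G).Finite) (hk : 1 ≤ k) (hX : X ⊆ E(G)) :
    (∀ C ⊆ X, C ∉ G.kCircuits k) ↔ ∀ Y ⊆ X, (G.edgeInduce Y).excess < k := by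
  constructor
  · intro h Y hY
    by_contra hcon
    obtain ⟨C, hCY, hC⟩ := exists_minimal_excess hE (hY.trans hX) (not_lt.1 hcon)
    exact h C (hCY.trans hY) ((mem_kCircuits_iff hE hk (hCY.trans (hY.trans hX))).2 hC)
  · intro h C hC hmem
    have h1 := h C hC
    rw [hmem.2.1] at h1
    exact lt_irrefl _ h1

lemma kCircuits_aug (hE : E(G).Finite) {I J : Set β} (hI : I ⊆ E(G)) (hJ : J ⊆ E(G))
    (hIi : ∀ Y ⊆ I, (G.edgeInduce Y).excess < k) (hJi : ∀ Y ⊆ J, (G.edgeInduce Y).excess < k)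
    (hlt : I.ncard < J.ncard) :
    ∃ e ∈ J, e ∉ I ∧ ∀ Y ⊆ insert e I, (G.edgeInduce Y).excess < k := by
  by_contra! hcon
  have fI := hE.subset hI
  have fJ := hE.subset hJ
  have hcard : (I \ J).ncard < (J \ I).ncard := by
    have h1 := Set.ncard_inter_add_ncard_sdiff_eq_ncard I J fI
    have h2 := Set.ncard_inter_add_ncard_sdiff_eq_ncard J I fJ
    rw [Set.inter_comm] at h2
    omega
  have grow : ∀ T : Set β, T.Finite → T ⊆ J \ I →
      ∃ Y ⊆ I ∪ T, (k : ℤ) - 1 + T.ncard ≤ (G.edgeInduce Y).excess := by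
    intro T fT
    induction T, fT using Set.Finite.induction_on with
    | empty =>
      intro _
      obtain ⟨e, heJ, heI⟩ : (J \ I).Nonempty := by
        rw [← Set.ncard_pos fJ.sdiff]; omega
      obtain ⟨Y, hY, hk⟩ := hcon e heJ heI
      have hYE : Y ⊆ E(G) := hY.trans (Set.insert_subset (hJ heJ) hI)
      refine ⟨Y ∩ I, by simp, ?_⟩
      have h1 := excess_le_of_subset hE hYE (Set.inter_subset_left (s := Y) (t := I))
      have h2 : (Y \ (Y ∩ I)).ncard ≤ ({e} : Set β).ncard := by
        refine Set.ncard_le_ncard ?_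
        rintro x ⟨hx, hn⟩
        rcases hY hx with h | h
        · exact h
        · exact absurd ⟨hx, h⟩ hn
      rw [Set.ncard_singleton] at h2
      simp only [Set.ncard_empty]
      push_cast
      omega
    | @insert e T heT fT ih =>
      intro hsub
      obtain ⟨Y₁, hY₁, h1⟩ := ih ((Set.subset_insert _ _).trans hsub)
      have he := hsub (Set.mem_insert _ _)
      obtain ⟨Y₂, hY₂, h2⟩ := hcon e he.1 he.2
      have hT : T ⊆ J \ I := (Set.subset_insert _ _).trans hsub
      have s1 : Y₁ ⊆ E(G) := hY₁.trans (Set.union_subset hI fun x hx => hJ (hT hx).1)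
      have s2 : Y₂ ⊆ E(G) := hY₂.trans (Set.insert_subset (hJ he.1) hI)
      refine ⟨Y₁ ∪ Y₂, ?_, ?_⟩
      · refine Set.union_subset (hY₁.trans ?_) (hY₂.trans ?_)
        · exact Set.union_subset_union_right _ (Set.subset_insert _ _)
        · exact Set.insert_subset (Or.inr (Set.mem_insert _ _)) Set.subset_union_left
      · have h3 := excess_supermodular hE s1 s2
        have h4 := hIi (Y₁ ∩ Y₂) (by
          rintro x ⟨hx1, hx2⟩
          rcases hY₂ hx2 with rfl | h
          · rcases hY₁ hx1 with h | h
            · exact h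
            · exact absurd h heT
          · exact h)
        rw [Set.ncard_insert_of_notMem heT fT]
        push_cast
        omega
  obtain ⟨Y, hY, h1⟩ := grow (J \ I) fJ.sdiff subset_rfl
  have hYE : Y ⊆ E(G) := hY.trans (Set.union_subset hI (Set.sdiff_subset.trans hJ))
  have h2 := excess_le_of_subset hE hYE (Set.inter_subset_left (s := Y) (t := J))
  have h3 := hJi (Y ∩ J) Set.inter_subset_right
  have h4 : (Y \ (Y ∩ J)).ncard ≤ (I \ J).ncard := by
    refine Set.ncard_le_ncard ?_ fI.sdiff
    rintro x ⟨hx, hn⟩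
    have hxJ : x ∉ J := fun h => hn ⟨hx, h⟩
    rcases hY hx with h | h
    · exact ⟨h, hxJ⟩
    · exact absurd h.1 hxJ
  omega

end Aux

/-- The `k`-circular matroid `M_k(G)` of a graph `G` with finitely many edges, `k ≥ 1`: the matroid
on `E(G)` whose independent sets are the sets of edges that contain no member of `C_k(G)`. -/
def kCircularMatroid (G : Graph α β) (hE : E(G).Finite) (k : ℕ) (hk : 1 ≤ k) : Matroid β :=
  (IndepMatroid.ofFinite hE (fun I => I ⊆ E(G) ∧ ∀ C ⊆ I, C ∉ G.kCircuits k)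
    (by
      refine ⟨Set.empty_subset _, ?_⟩
      rw [forall_notMem_kCircuits_iff hE hk (Set.empty_subset _)]
      intro Y hY
      rw [Set.subset_empty_iff.1 hY, excess_empty]
      omega)
    (fun _ _ hJ hIJ => ⟨hIJ.trans hJ.1, fun C hC => hJ.2 C (hC.trans hIJ)⟩)
    (by
      rintro I J ⟨hI, hIi⟩ ⟨hJ, hJi⟩ hlt
      rw [forall_notMem_kCircuits_iff hE hk hI] at hIi
      rw [forall_notMem_kCircuits_iff hE hk hJ] at hJi
      obtain ⟨e, heJ, heI, h⟩ := kCircuits_aug hE hI hJ hIi hJi hlt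
      have hs : insert e I ⊆ E(G) := Set.insert_subset (hJ heJ) hI
      exact ⟨e, heJ, heI, hs, (forall_notMem_kCircuits_iff hE hk hs).2 h⟩)
    (fun _ h => h.1)).matroid

/-- The circuits of `M_k(G)` are exactly the members of `C_k(G)`. -/
lemma kCircularMatroid_isCircuit_iff (G : Graph α β) (hE : E(G).Finite) (k : ℕ) (hk : 1 ≤ k)
    (C : Set β) : (G.kCircularMatroid hE k hk).IsCircuit C ↔ C ∈ G.kCircuits k := by
  have hind : ∀ I, (G.kCircularMatroid hE k hk).Indep I ↔
      I ⊆ E(G) ∧ ∀ C ⊆ I, C ∉ G.kCircuits k := fun I => Iff.rfl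
  have hgr : (G.kCircularMatroid hE k hk).E = E(G) := rfl
  rw [Matroid.isCircuit_iff_forall_ssubset, Matroid.Dep, hind, hgr]
  constructor
  · rintro ⟨⟨h1, hCE⟩, h2⟩
    have : ∃ D ⊆ C, D ∈ G.kCircuits k := by
      by_contra! hcon
      exact h1 ⟨hCE, hcon⟩
    obtain ⟨D, hDC, hD⟩ := this
    rcases eq_or_ssubset_of_subset hDC with rfl | hss
    · exact hD
    · exact absurd hD (((hind D).1 (h2 hss)).2 D subset_rfl)
  · intro h
    refine ⟨⟨fun h1 => h1.2 C subset_rfl h, h.1⟩, fun I hI => (hind I).2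
      ⟨hI.subset.trans h.1, fun D hD hmem => ?_⟩⟩
    have h1 := ((mem_kCircuits_iff hE hk h.1).1 h).2 D (hD.trans_ssubset hI)
    rw [hmem.2.1] at h1
    exact lt_irrefl _ h1

end Graph

/-! The plan is to recover numbers of vertices, and then stars, from the matroid alone. Call an edge
set tight if its excess is at least k and drops on every proper subset. Tight sets are exactly the
non-empty unions of circuits (`isTight_of_forall_mem_kCircuits`, `IsTight.excess_eq`). The excess of
a tight set is k - 1 plus its nullity in the matroid: an independent set has excess at most k - 1,
each added edge contributes at most 1, and successive fundamental circuits each contribute at least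
1. Hence tightness, the excess and so the number of vertices spanned agree in G and G'
(`IsTight.of_kCircuits_eq`).

By (a1), E(G) is tight, so |V(G)| = |V(G')|. By (a2), the set H of edges avoiding a vertex x is
tight and spans |V(G)| - 1 vertices, so in G' it misses exactly one vertex x'. The star of x' lies
in the star of x, since edges of H miss x'. If an edge e of the star of x missed x', adding it to H
would raise the excess by 1 in G'; in G it adds the new vertex x and cannot. So the two stars
coincide (`exists_incidenceSet_eq`). The map from x to x' is injective, hence bijective by counting,
and stars determine the ends of every edge. -/

namespace Graph

section Tight

variable {α β : Type*} {G : Graph α β} {X Y I : Set β} {k : ℕ}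

/-! ### Tight sets and unions of circuits -/

/-- A set of edges of excess at least `k`, all of whose proper subsets have smaller excess. -/
def IsTight (G : Graph α β) (k : ℕ) (X : Set β) : Prop :=
  (k : ℤ) ≤ (G.edgeInduce X).excess ∧
    ∀ D ⊂ X, (G.edgeInduce D).excess < (G.edgeInduce X).excess

lemma IsTight.excess_le (h : G.IsTight k X) (hY : Y ⊆ X) :
    (G.edgeInduce Y).excess ≤ (G.edgeInduce X).excess := by
  rcases eq_or_ssubset_of_subset hY with rfl | hss
  exacts [le_rfl, (h.2 _ hss).le]

/-- With m its own excess, X is a circuit at level m rather than k, and the minimality of circuits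
at level m is the tightness of X. -/
lemma isTight_of_isCactiGraph (hE : E(G).Finite) (hk : 1 ≤ k) (hX : X ⊆ E(G))
    (hex : (k : ℤ) ≤ (G.edgeInduce X).excess) (hc : (G.edgeInduce X).IsCactiGraph) :
    G.IsTight k X := by
  obtain ⟨m, hm⟩ := Int.eq_ofNat_of_zero_le (a := (G.edgeInduce X).excess) (by omega)
  have h := (mem_kCircuits_iff hE (k := m) (by omega) hX).1 ⟨hX, hm, hc⟩
  exact ⟨hex, fun D hD => hm ▸ h.2 D hD⟩

/-- Adding to a set of edges a circuit that it does not contain increases the excess. -/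
lemma excess_lt_excess_union (hE : E(G).Finite) (hk : 1 ≤ k) (hX : X ⊆ E(G)) {C : Set β}
    (hC : C ∈ G.kCircuits k) (hCX : ¬ C ⊆ X) :
    (G.edgeInduce X).excess < (G.edgeInduce (X ∪ C)).excess := by
  have h1 := excess_supermodular hE hX hC.1
  have h2 := ((mem_kCircuits_iff hE hk hC.1).1 hC).2 (X ∩ C)
    ⟨Set.inter_subset_right, fun h => hCX (h.trans Set.inter_subset_left)⟩
  have h3 := hC.2.1
  omega

/-- A non-empty union of circuits is tight. -/
lemma isTight_of_forall_mem_kCircuits (hE : E(G).Finite) (hk : 1 ≤ k) (hX : X ⊆ E(G))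
    (hne : X.Nonempty) (h : ∀ e ∈ X, ∃ C ∈ G.kCircuits k, e ∈ C ∧ C ⊆ X) : G.IsTight k X := by
  have fX := hE.subset hX
  have key : ∀ D ⊂ X, (G.edgeInduce D).excess < (G.edgeInduce X).excess := by
    intro D hD
    -- Take a proper subset M of largest excess. A circuit in X through an edge outside M raises the
    -- excess, so by maximality its union with M is all of X.
    obtain ⟨M, hM, hmax⟩ := Set.exists_max_image {D | D ⊂ X} (fun D => (G.edgeInduce D).excess)
      (fX.finite_subsets.subset fun D (hD : D ⊂ X) => hD.subset) ⟨D, hD⟩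
    have hM : M ⊂ X := hM
    refine (hmax D hD).trans_lt ?_
    obtain ⟨e, heX, heM⟩ := Set.exists_of_ssubset hM
    obtain ⟨C, hC, heC, hCX⟩ := h e heX
    have h1 := excess_lt_excess_union hE hk (hM.subset.trans hX) hC fun h => heM (h heC)
    rcases eq_or_ssubset_of_subset (Set.union_subset hM.subset hCX) with h2 | h2
    · rwa [h2] at h1
    · exact absurd (hmax _ h2) (not_le.2 h1)
  refine ⟨?_, key⟩
  obtain ⟨e, he⟩ := hne
  obtain ⟨C, hC, -, hCX⟩ := h e he
  rw [← hC.2.1]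
  rcases eq_or_ssubset_of_subset hCX with rfl | hss
  exacts [le_rfl, (key C hss).le]

/-! ### Excess as nullity, and matroid invariance -/

/-- The union of the fundamental circuits of finitely many edges outside `I`. -/
lemma exists_union_of_fundamental_kCircuits (hE : E(G).Finite) (hk : 1 ≤ k) {T : Set β}
    (fT : T.Finite) (hIT : Disjoint T I)
    (h : ∀ e ∈ T, ∃ C ∈ G.kCircuits k, e ∈ C ∧ C ⊆ insert e I) (hne : T.Nonempty) :
    ∃ Y ⊆ I ∪ T, (∀ e ∈ Y, ∃ C ∈ G.kCircuits k, e ∈ C ∧ C ⊆ Y) ∧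
      (k : ℤ) - 1 + T.ncard ≤ (G.edgeInduce Y).excess := by
  induction T, fT using Set.Finite.induction_on with
  | empty => exact absurd hne Set.not_nonempty_empty
  | @insert e T heT fT ih =>
    obtain ⟨C, hC, heC, hCI⟩ := h e (Set.mem_insert _ _)
    have hCIT : C ⊆ I ∪ insert e T :=
      hCI.trans (Set.insert_subset (Or.inr (Set.mem_insert _ _)) Set.subset_union_left)
    -- The count starts at one circuit, of excess k = (k - 1) + 1. Each later circuit contains its
    -- own edge of T, which Y lacks, so it raises the excess by at least 1.
    rcases T.eq_empty_or_nonempty with rfl | hT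
    · refine ⟨C, hCIT, fun f hf => ⟨C, hC, hf, subset_rfl⟩, ?_⟩
      rw [hC.2.1, Set.ncard_insert_of_notMem heT fT]
      simp
    · obtain ⟨Y, hY, hYC, hYex⟩ := ih (hIT.mono_left (Set.subset_insert _ _))
        (fun f hf => h f (Set.mem_insert_of_mem _ hf)) hT
      have hYE : Y ⊆ E(G) := by
        intro f hf
        obtain ⟨D, hD, hfD, -⟩ := hYC f hf
        exact hD.1 hfD
      refine ⟨Y ∪ C, Set.union_subset (hY.trans
        (Set.union_subset_union_right _ (Set.subset_insert _ _))) hCIT, ?_, ?_⟩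
      · rintro f (hf | hf)
        · obtain ⟨D, hD, hfD, hDY⟩ := hYC f hf
          exact ⟨D, hD, hfD, hDY.trans Set.subset_union_left⟩
        · exact ⟨C, hC, hf, Set.subset_union_right⟩
      · have heY : e ∉ Y := fun he => by
          rcases hY he with h1 | h1
          · exact Set.disjoint_left.1 hIT (Set.mem_insert _ _) h1
          · exact heT h1
        have h1 := excess_lt_excess_union hE hk hYE hC fun h => heY (h heC)
        rw [Set.ncard_insert_of_notMem heT fT]
        push_cast
        omega

/-- A tight set is a union of circuits, and its excess is determined by its nullity. -/
lemma IsTight.excess_eq (hX : G.IsTight k X) (hE : E(G).Finite) (hk : 1 ≤ k) (hXE : X ⊆ E(G))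
    (hI : I ⊆ X) (hIi : ∀ C ⊆ I, C ∉ G.kCircuits k)
    (h : ∀ e ∈ X \ I, ∃ C ∈ G.kCircuits k, e ∈ C ∧ C ⊆ insert e I) :
    (∀ e ∈ X, ∃ C ∈ G.kCircuits k, e ∈ C ∧ C ⊆ X) ∧
      (G.edgeInduce X).excess = (k : ℤ) - 1 + (X \ I).ncard := by
  have hIE := hI.trans hXE
  -- I has excess at most k - 1, so X has excess at most k - 1 + |X \ I|. The union Y of fundamental
  -- circuits already reaches this bound, so tightness forces Y = X.
  have h1 := (forall_notMem_kCircuits_iff hE hk hIE).1 hIi I subset_rfl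
  have h2 := excess_le_of_subset hE hXE hI
  have h3 := hX.1
  have fXI : (X \ I).Finite := (hE.subset hXE).sdiff
  obtain ⟨Y, hY, hYC, hYex⟩ := exists_union_of_fundamental_kCircuits hE hk fXI
    Set.disjoint_sdiff_left h (by rw [← Set.ncard_pos fXI]; omega)
  rw [Set.union_sdiff_cancel hI] at hY
  rcases eq_or_ssubset_of_subset hY with rfl | hss
  · exact ⟨hYC, by omega⟩
  · have := hX.2 Y hss
    omega

/-- Tightness and the excess of tight sets depend only on the family of circuits. -/
lemma IsTight.of_kCircuits_eq {α' : Type*} {G' : Graph α' β} (hX : G.IsTight k X)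
    (hE : E(G).Finite) (hE' : E(G').Finite) (hk : 1 ≤ k) (hXE : X ⊆ E(G)) (hXE' : X ⊆ E(G'))
    (hC : G.kCircuits k = G'.kCircuits k) :
    G'.IsTight k X ∧ (G'.edgeInduce X).excess = (G.edgeInduce X).excess := by
  have fX := hE.subset hXE
  -- A largest circuit-free subset of X serves as a basis; maximality supplies the fundamental
  -- circuits. Since the circuits agree, the same I computes the nullity for both graphs.
  obtain ⟨I, ⟨hIX, hIi⟩, hmax⟩ := Set.exists_max_image
    {I | I ⊆ X ∧ ∀ C ⊆ I, C ∉ G.kCircuits k} Set.ncard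
    (fX.finite_subsets.subset fun D hD => hD.1)
    ⟨∅, Set.empty_subset _, by
      rw [forall_notMem_kCircuits_iff hE hk (Set.empty_subset _)]
      intro Y hY
      rw [Set.subset_empty_iff.1 hY, excess_empty]
      omega⟩
  have hfund : ∀ e ∈ X \ I, ∃ C ∈ G.kCircuits k, e ∈ C ∧ C ⊆ insert e I := by
    intro e he
    by_contra! hcon
    have h1 := hmax (insert e I) ⟨Set.insert_subset he.1 hIX, fun C hCI hmem => by
      by_cases heC : e ∈ C
      · exact hcon C hmem heC hCI
      · exact hIi C ((Set.subset_insert_iff_of_notMem heC).1 hCI) hmem⟩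
    rw [Set.ncard_insert_of_notMem he.2 (fX.subset hIX)] at h1
    omega
  obtain ⟨hu, hex⟩ := hX.excess_eq hE hk hXE hIX hIi hfund
  have hne : X.Nonempty := by
    rw [Set.nonempty_iff_ne_empty]
    rintro rfl
    have := hX.1
    rw [excess_empty] at this
    omega
  rw [hC] at hIi hfund hu
  have hX' := isTight_of_forall_mem_kCircuits hE' hk hXE' hne hu
  exact ⟨hX', (hX'.excess_eq hE' hk hXE' hIX hIi hfund).2.trans hex.symm⟩

/-- A tight set stays tight when an edge with both ends in its vertex set is added. -/
lemma IsTight.insert (hX : G.IsTight k X) (hE : E(G).Finite) (hXE : X ⊆ E(G)) {e : β}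
    (he : e ∈ E(G)) (heX : e ∉ X) (hV : ∀ v, G.Inc e v → v ∈ V(G.edgeInduce X)) :
    G.IsTight k (insert e X) ∧
      (G.edgeInduce (insert e X)).excess = (G.edgeInduce X).excess + 1 := by
  have hieE : Insert.insert e X ⊆ E(G) := Set.insert_subset he hXE
  have hVeq : V(G.edgeInduce (Insert.insert e X)) = V(G.edgeInduce X) := by
    refine subset_antisymm ?_ (edgeInduce_vertexSet_mono (Set.subset_insert _ _))
    rintro v ⟨f, rfl | hf, hfv⟩
    exacts [hV v hfv, ⟨f, hf, hfv⟩]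
  have hex : (G.edgeInduce (Insert.insert e X)).excess = (G.edgeInduce X).excess + 1 := by
    rw [edgeInduce_excess hieE, edgeInduce_excess hXE, hVeq,
      Set.ncard_insert_of_notMem heX (hE.subset hXE)]
    push_cast
    ring
  refine ⟨⟨by have := hX.1; omega, fun D hD => ?_⟩, hex⟩
  -- If e lies in D, removing it leaves a proper subset of X, and restoring it gains at most 1.
  -- Otherwise D lies in X, whose excess is one less than that of the enlarged set.
  by_cases heD : e ∈ D
  · have hss : D \ {e} ⊂ X := by
      refine ⟨by simpa [Set.sdiff_subset_iff] using hD.subset, fun h => hD.not_subset ?_⟩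
      exact Set.insert_subset heD (h.trans Set.sdiff_subset)
    have h1 := hX.2 _ hss
    have h2 := excess_le_of_subset hE (hD.subset.trans hieE) (Set.sdiff_subset (s := D) (t := {e}))
    rw [Set.sdiff_sdiff_cancel_left (by simpa using heD), Set.ncard_singleton] at h2
    push_cast at h2
    omega
  · have := hX.excess_le ((Set.subset_insert_iff_of_notMem heD).1 hD.subset)
    omega

/-! ### From graphs without isolated vertices to edge sets -/

lemma inc_of_not_isIsolated {v : α} (hv : v ∈ V(G)) (h : ¬ G.IsIsolated v) : ∃ e, G.Inc e v := by
  by_contra! hcon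
  exact h ⟨hv, Set.eq_empty_of_forall_notMem hcon⟩

lemma edgeInduce_edgeSet_eq_self (h : ∀ v, ¬ G.IsIsolated v) : G.edgeInduce E(G) = G := by
  refine Graph.ext ?_ fun e x y => by
    rw [edgeInduce_isLink]
    exact ⟨fun h => h.1, fun h => ⟨h, h.edge_mem⟩⟩
  ext v
  refine ⟨fun ⟨e, _, hev⟩ => hev.vertex_mem, fun hv => ?_⟩
  obtain ⟨e, he⟩ := inc_of_not_isIsolated hv (h v)
  exact ⟨e, he.edge_mem, he⟩

/-- Without isolated vertices, the vertex-deleted graph is spanned by its edges, so (a2) becomes a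
statement about an edge set. -/
lemma edgeInduce_sdiff_incidenceSet {x : α} (h : ∀ v, ¬ (G.deleteVerts {x}).IsIsolated v) :
    G.edgeInduce (E(G) \ G.incidenceSet x) = G.deleteVerts {x} := by
  have hlink : ∀ e y z, (G.edgeInduce (E(G) \ G.incidenceSet x)).IsLink e y z ↔
      (G.deleteVerts {x}).IsLink e y z := by
    intro e y z
    simp only [edgeInduce_isLink, deleteVerts_isLink, Set.mem_sdiff, mem_incidenceSet,
      Set.mem_singleton_iff]
    constructor
    · rintro ⟨h, -, hn⟩
      exact ⟨h, fun hy => hn (hy ▸ h.inc_left), fun hz => hn (hz ▸ h.inc_right)⟩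
    · rintro ⟨h, hy, hz⟩
      refine ⟨h, h.edge_mem, fun hx => ?_⟩
      rcases hx.eq_or_eq_of_isLink h with h | h
      exacts [hy h.symm, hz h.symm]
  refine Graph.ext ?_ hlink
  ext v
  constructor
  · rintro ⟨e, he, hev⟩
    obtain ⟨w, hw⟩ := hev
    exact ((hlink e v w).1 (edgeInduce_isLink.2 ⟨hw, he⟩)).left_mem
  · intro hv
    obtain ⟨e, w, hw⟩ := inc_of_not_isIsolated hv (h v)
    exact ((hlink e v w).2 hw).left_mem

/-! ### Stars and strong isomorphism -/

/-- A bijection of the vertex sets that preserves the stars is a strong isomorphism. -/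
lemma stronglyIsomorphic_of_incidenceSet_eq {α' : Type*} {G' : Graph α' β} (hEE : E(G) = E(G'))
    (ν : V(G) ≃ V(G')) (h : ∀ x : V(G), G'.incidenceSet (ν x) = G.incidenceSet x) :
    G.StronglyIsomorphic G' := by
  have hinc : ∀ e (x : V(G)), G'.Inc e (ν x) ↔ G.Inc e x := fun e x => Set.ext_iff.1 (h x) e
  refine ⟨hEE, ν, fun e x y => ?_⟩
  -- An edge links x and y exactly when both are incident to it and no other vertex is, so
  -- incidences determine links, loops included.
  rw [isLink_iff_inc, isLink_iff_inc, hinc, hinc]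
  refine and_congr_right fun _ => and_congr_right fun _ => ⟨fun hz z hez => ?_, fun hz z hez => ?_⟩
  · obtain ⟨w, hw⟩ := ν.surjective ⟨z, hez.vertex_mem⟩
    have hw' : z = (ν w : α') := by rw [hw]
    subst hw'
    refine (hz w ((hinc e w).1 hez)).imp (fun h => ?_) (fun h => ?_) <;> rw [Subtype.ext h]
  · have := hz (ν ⟨z, hez.vertex_mem⟩) ((hinc e ⟨z, hez.vertex_mem⟩).2 hez)
    refine this.imp (fun h => ?_) (fun h => ?_) <;>
      exact congrArg Subtype.val (ν.injective (Subtype.ext h))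

/-- If the edges avoiding `x` form a tight set in `G`, and the families of circuits of `G` and `G'`
agree, then the star of `x` is also a star of `G'`. -/
lemma exists_incidenceSet_eq {α' : Type*} {G' : Graph α' β} (hV' : V(G').Finite)
    (hE : E(G).Finite) (hE' : E(G').Finite) (hEE : E(G) = E(G')) (hk : 1 ≤ k)
    (hC : G.kCircuits k = G'.kCircuits k) {x : α}
    (ht : G.IsTight k (E(G) \ G.incidenceSet x))
    (hcard : V(G.edgeInduce (E(G) \ G.incidenceSet x)).ncard + 1 = V(G').ncard) :
    ∃ x' ∈ V(G'), G'.incidenceSet x' = G.incidenceSet x := by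
  set H := E(G) \ G.incidenceSet x with hH
  have hHE : H ⊆ E(G) := Set.sdiff_subset
  have hHE' : H ⊆ E(G') := hEE ▸ hHE
  obtain ⟨ht', hex⟩ := ht.of_kCircuits_eq hE hE' hk hHE hHE' hC
  have hsub : V(G'.edgeInduce H) ⊆ V(G') := fun v ⟨e, _, hev⟩ => hev.vertex_mem
  rw [edgeInduce_excess hHE, edgeInduce_excess hHE'] at hex
  -- Equal excess on the same edges means equal numbers of vertices, so H misses exactly one vertex
  -- of G'.
  have hone : (V(G') \ V(G'.edgeInduce H)).ncard = 1 := by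
    have := Set.ncard_sdiff_add_ncard_of_subset hsub hV'
    omega
  obtain ⟨x', hx'⟩ := Set.ncard_eq_one.1 hone
  have hxm : x' ∈ V(G') \ V(G'.edgeInduce H) := hx' ▸ rfl
  refine ⟨x', hxm.1, subset_antisymm (fun e he => ?_) fun e he => ?_⟩
  · by_contra hcon
    exact hxm.2 ⟨e, ⟨hEE ▸ he.edge_mem, hcon⟩, he⟩
  · by_contra hcon
    have heE : e ∈ E(G) := G.incidenceSet_subset_edgeSet x he
    have heH : e ∉ H := fun h => h.2 he
    -- As e avoids x', the only vertex missed by H in G', both its ends are already spanned there.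
    obtain ⟨ht2, hex2⟩ := ht'.insert hE' hHE' (hEE ▸ heE) heH fun v hv => by
      by_contra hn
      have : v ∈ V(G') \ V(G'.edgeInduce H) := ⟨hv.vertex_mem, hn⟩
      rw [hx'] at this
      exact hcon (Set.mem_singleton_iff.1 this ▸ hv)
    have hs : Insert.insert e H ⊆ E(G) := Set.insert_subset heE hHE
    have hs' : Insert.insert e H ⊆ E(G') := hEE ▸ hs
    have hex3 := (ht2.of_kCircuits_eq hE' hE hk hs' hs hC.symm).2
    rw [hex2, edgeInduce_excess hs, edgeInduce_excess hHE',
      Set.ncard_insert_of_notMem heH (hE.subset hHE)] at hex3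
    -- In G no edge of H meets x, so adding e brings in x as a new vertex. By `hex3` the number of
    -- vertices would have to stay the same.
    have hlt : V(G.edgeInduce H).ncard < V(G.edgeInduce (Insert.insert e H)).ncard := by
      refine Set.ncard_lt_ncard ⟨edgeInduce_vertexSet_mono (Set.subset_insert _ _), fun h => ?_⟩
        (G.edgeInduce_vertexSet_finite (hE.subset hs))
      obtain ⟨f, hf, hfx⟩ := h ⟨e, Set.mem_insert _ _, he⟩
      exact hf.2 hfx
    push_cast at hex3
    omega

end Tight

end Graph

/-! ### The main theorem -/

theorem mainTheorem11 {α α' β : Type*} (G : Graph α β) (G' : Graph α' β)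
    (hV : V(G).Finite) (hE : E(G).Finite) (hV' : V(G').Finite) (hE' : E(G').Finite)
    (hiso' : ∀ v, ¬ G'.IsIsolated v)
    (k : ℕ) (hk : 2 ≤ k)
    (h1 : (k : ℤ) ≤ G.excess ∧ G.IsCactiGraph)
    (h2 : ∀ x ∈ V(G), (k : ℤ) ≤ (G.deleteVerts {x}).excess ∧ (G.deleteVerts {x}).IsCactiGraph)
    (h3 : G'.kCircularMatroid hE' k (one_le_two.trans hk) =
      G.kCircularMatroid hE k (one_le_two.trans hk)) :
    G.vertexStars = G'.vertexStars ∧ G.StronglyIsomorphic G' := by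
  have hk1 : 1 ≤ k := one_le_two.trans hk
  have hEE : E(G) = E(G') := (congrArg Matroid.E h3).symm
  have hC : G.kCircuits k = G'.kCircuits k := by
    ext C
    rw [← Graph.kCircularMatroid_isCircuit_iff G hE k hk1,
      ← Graph.kCircularMatroid_isCircuit_iff G' hE' k hk1,
      h3]
  have hGE := Graph.edgeInduce_edgeSet_eq_self h1.2.1
  have hGE' := Graph.edgeInduce_edgeSet_eq_self hiso'
  have hcard : V(G).ncard = V(G').ncard := by
    have ht : G.IsTight k E(G) := Graph.isTight_of_isCactiGraph hE hk1 subset_rfl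
      (hGE.symm ▸ h1.1) (hGE.symm ▸ h1.2)
    have h := (ht.of_kCircuits_eq hE hE' hk1 subset_rfl hEE.subset hC).2
    rw [hGE, hEE, hGE', Graph.excess, Graph.excess, hEE] at h
    omega
  have hstar : ∀ x : V(G), ∃ x' : V(G'), G'.incidenceSet x' = G.incidenceSet x := by
    intro x
    have hd := Graph.edgeInduce_sdiff_incidenceSet (h2 x x.2).2.1
    have ht : G.IsTight k (E(G) \ G.incidenceSet x) := Graph.isTight_of_isCactiGraph hE hk1
      Set.sdiff_subset (hd.symm ▸ (h2 x x.2).1) (hd.symm ▸ (h2 x x.2).2)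
    obtain ⟨x', hx', h⟩ := Graph.exists_incidenceSet_eq hV' hE hE' hEE hk1 hC ht (by
      rw [hd, Graph.vertexSet_deleteVerts, Set.ncard_sdiff_singleton_add_one x.2 hV, hcard])
    exact ⟨⟨x', hx'⟩, h⟩
  choose ν hν using hstar
  have hinj : Function.Injective ν := by
    intro x y hxy
    by_contra hne
    -- Two distinct vertices with the same star are impossible: deleting x would leave y isolated.
    have hS : G.incidenceSet x = G.incidenceSet y := by rw [← hν, ← hν, hxy]
    obtain ⟨e, w, hw⟩ := Graph.inc_of_not_isIsolated (G := G.deleteVerts {x.1}) (v := y.1)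
      (by simpa using fun h => hne (Subtype.ext h.symm)) ((h2 x x.2).2.1 y)
    rw [Graph.deleteVerts_isLink] at hw
    have hex : e ∈ G.incidenceSet x := hS ▸ hw.1.inc_left
    rcases Graph.Inc.eq_or_eq_of_isLink hex hw.1 with h | h
    exacts [hw.2.1 h.symm, hw.2.2 h.symm]
  have hbij : Function.Bijective ν := by
    have := hV.to_subtype
    have := hV'.to_subtype
    exact (Nat.bijective_iff_injective_and_card ν).2 ⟨hinj, hcard⟩
  refine ⟨?_, Graph.stronglyIsomorphic_of_incidenceSet_eq hEE (Equiv.ofBijective ν hbij) hν⟩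
  ext S
  constructor
  · rintro ⟨x, hx, rfl⟩
    exact ⟨ν ⟨x, hx⟩, (ν ⟨x, hx⟩).2, (hν ⟨x, hx⟩).symm⟩
  · rintro ⟨x', hx', rfl⟩
    obtain ⟨x, hx⟩ := hbij.2 ⟨x', hx'⟩
    exact ⟨x, x.2, by rw [← hν, hx]⟩
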